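/- **Theorem.** Let $k\ge 1$ be an integer and $\sigma>0$. There is a constant $C_{k,\sigma}>0$, depending only on $k$ and $\sigma$, with the following property. Let $X$ be a real random variable with $\mathbb{E}[X^2]<\infty$, let $N\sim\mathcal{N}(0,\sigma^2)$ be independent of $X$, put $Y=X+N$, and let $Y_1,Y_2,\dots$ be i.i.d. with the law of $Y$. Write $f_Y(y)=\mathbb{E}[\phi_{\sigma^2}(y-X)]$ for the density of $Y$, where $\phi_{\sigma^2}$ is the density of $\mathcal{N}(0,\sigma^2)$, and, for every $y\in\mathbb{R}$, $$\mathbb{E}[X^k\mid Y=y]=\int x^k\,dP_{X|Y=y}(x),\qquad dP_{X|Y=y}(x)=\frac{\phi_{\sigma^2}(y-x)}{f_Y(y)}\,dP_X(x).$$ Let $0<u<\frac{1}{2k+4}$ and $0<w<u$, and for $n\ge 1$ set $$a=n^{-u},\qquad t_n=\sqrt{\frac{\sigma^2\,w\log n}{3}}.$$ Let $\widehat f_Y(y)=\frac1n\sum_{i=1}^n\frac1a\,\phi\!\left(\frac{y-Y_i}{a}\right)$ with $\phi(x)=\frac{1}{\sqrt{2\pi}}e^{-x^2/2}$, let $\widehat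 f_Y^{(j)}$ be its $j$-th derivative, and let $$\widehat m_k(y)=\sigma^{2k}\,\frac{\sum_{m=0}^k\binom{k}{m}\widehat f_Y^{(k-m)}(y)\,\frac{(-i)^m}{\sigma^m}\,He_m\!\left(\frac{iy}{\sigma}\right)}{\widehat f_Y(y)},$$ where $i=\sqrt{-1}$ and $He_m$ is the probabilists' Hermite polynomial of degree $m$. Then $$\lim_{n\to\infty}\mathbb{P}\left[\ \sup_{|y|\le t_n}\bigl|\widehat m_k(y)-\mathbb{E}[X^k\mid Y=y]\bigr|\ \ge\ \frac{C_{k,\sigma}}{n^{u-w}}\right]=0 .$$ -/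

import Mathlib

open MeasureTheory ProbabilityTheory
open scoped NNReal ENNReal

noncomputable section

namespace GaussianEB

/-- The density `f_Y(y) = E[φ_{σ²}(y - X)]` of `Y = X + N`, where `X` has law `Q` and
`N ∼ N(0, σ²)` is independent of `X`. -/
def outputDensity (Q : Measure ℝ) (σ : ℝ≥0) (y : ℝ) : ℝ :=
  ∫ x, gaussianPDFReal 0 (σ ^ 2) (y - x) ∂Q

/-- The conditional law of `X` given `Y = y`, defined for every real `y` by Bayes' formula
`dP_{X|Y=y}(x) = φ_{σ²}(y - x) / f_Y(y) dP_X(x)`. -/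
def condLaw (Q : Measure ℝ) (σ : ℝ≥0) (y : ℝ) : Measure ℝ :=
  Q.withDensity fun x =>
    ENNReal.ofReal (gaussianPDFReal 0 (σ ^ 2) (y - x) / outputDensity Q σ y)

/-- The conditional moment `E[X^k | Y = y] = ∫ x^k dP_{X|Y=y}(x)`, where `X` has law `Q`. -/
def condMoment (Q : Measure ℝ) (σ : ℝ≥0) (k : ℕ) (y : ℝ) : ℝ :=
  ∫ x, x ^ k ∂(condLaw Q σ y)

/-- The kernel `φ(x) = (2π)^{-1/2} exp(-x²/2)`. -/
def kernel (x : ℝ) : ℝ :=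
  1 / Real.sqrt (2 * Real.pi) * Real.exp (-x ^ 2 / 2)

/-- The kernel density estimator with bandwidth `a`, from the data `s 0, …, s (n - 1)`. -/
def kde (a : ℝ) {n : ℕ} (s : Fin n → ℝ) (y : ℝ) : ℝ :=
  1 / (n : ℝ) * ∑ i, 1 / a * kernel ((y - s i) / a)

/-- The estimator of `f_Y^{(j)}(y)`: the `j`-th derivative of the kernel density estimator. -/
def kdeDeriv (j : ℕ) (a : ℝ) {n : ℕ} (s : Fin n → ℝ) (y : ℝ) : ℝ :=
  iteratedDeriv j (kde a s) y

/-- The plug-in estimator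
`σ^{2k} (∑_{m ≤ k} (k choose m) f̂^{(k-m)}(y) (-i)^m σ^{-m} He_m(i y / σ)) / f̂(y)` of
`E[X^k | Y = y]`, with the probabilists' Hermite polynomials `He_m`. It is real-valued, but it is
written with complex numbers, and is kept here as a complex number. -/
def momentEstimator (σ : ℝ≥0) (k : ℕ) (a : ℝ) {n : ℕ} (s : Fin n → ℝ) (y : ℝ) : ℂ :=
  ((σ : ℝ) : ℂ) ^ (2 * k) *
    (∑ m ∈ Finset.range (k + 1),
      (k.choose m : ℂ) * (kdeDeriv (k - m) a s y : ℂ) *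
        ((-Complex.I) ^ m / ((σ : ℝ) : ℂ) ^ m) *
        Polynomial.aeval (Complex.I * ((y / (σ : ℝ) : ℝ) : ℂ)) (Polynomial.hermite m)) /
    (kde a s y : ℂ)

/-- The bandwidth `n^{-u}`. -/
def bandwidth (u : ℝ) (n : ℕ) : ℝ :=
  1 / (n : ℝ) ^ u

/-- The half-width `t_n = √(σ² w log n / 3)` of the interval on which the estimator is studied. -/
def halfWidth (σ : ℝ≥0) (w : ℝ) (n : ℕ) : ℝ :=
  Real.sqrt ((σ : ℝ) ^ 2 * w * Real.log n / 3)

/-- The uniform error `sup_{|y| ≤ t} |m̂_k(y) - E[X^k | Y = y]|`, as an element of `[0, ∞]`. -/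
def supError (Q : Measure ℝ) (σ : ℝ≥0) (k : ℕ) (a t : ℝ) {n : ℕ} (s : Fin n → ℝ) : ℝ≥0∞ :=
  ⨆ y : ℝ, ⨆ _ : |y| ≤ t,
    ENNReal.ofReal ‖momentEstimator σ k a s y - (condMoment Q σ k y : ℂ)‖

end GaussianEB

end

/-! The quotient defining the estimator is an exact formula for the conditional moment when `f_Y`
and its derivatives replace the kernel estimates. Indeed exp(y²/(2σ²)) φ_{σ²}(y - x) is a multiple
of exp(xy/σ²), whose k-th derivative in y brings out (x/σ²)^k; Leibniz' rule and the Hermite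
recurrence turn this into `pow_mul_gaussDeriv_zero`, and integrating over the law of X gives
`condMoment_eq`.

The derivatives are estimated uniformly over the whole line by Fourier inversion. The error at y is
an integral in which y enters only through a phase, so it is bounded by a weighted L¹ distance
between the empirical and true characteristic functions plus a bias O(a²) (`norm_kdeDeriv_sub_le`).
Pointwise the characteristic functions differ by at most 2/√n in mean, so Tonelli and Markov bound
the probability of an error above ε by a sum over j ≤ k of multiples of 1/(√n a^(j+1) ε)
(`measure_exists_kdeDeriv_sub_gt_le`). With a = ε = n^(-u) this vanishes because u(k+2) < 1/2.

Division costs at most 1/f_Y². Since f_Y(y) ≥ c exp(-y²/σ²) (`exists_le_outputDensity`), the density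
is at least c n^(-w/3) for |y| ≤ t_n. The quotient error is thus n^(-u+2w/3) times a power of 1 +
t_n, and the spare factor n^(-w/3) absorbs that power and all constants, including those depending
on the law of X (`eventually_rate_lt`). -/

noncomputable section

namespace GaussianEB

/-! ### Derivatives of the Gaussian density as Fourier integrals -/

/-- The weight `|t|^j exp(-(s t)² / 2)`. -/
def gaussWeight (s : ℝ) (j : ℕ) (t : ℝ) : ℝ :=
  |t| ^ j * Real.exp (-(s * t) ^ 2 / 2)

/-- The `j`-th derivative of the centred Gaussian density with standard deviation `s`, written as
an inverse Fourier transform. -/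
def gaussDeriv (s : ℝ) (j : ℕ) (z : ℝ) : ℂ :=
  (2 * Real.pi : ℂ)⁻¹ * ∫ t : ℝ, (Complex.I * t) ^ j * Complex.exp (Complex.I * t * z) *
    (Real.exp (-(s * t) ^ 2 / 2) : ℝ)

lemma gaussWeight_nonneg (s : ℝ) (j : ℕ) (t : ℝ) : 0 ≤ gaussWeight s j t := by
  unfold gaussWeight; positivity

lemma continuous_gaussWeight (s : ℝ) (j : ℕ) : Continuous (gaussWeight s j) := by
  unfold gaussWeight; fun_prop

lemma integrable_gaussWeight {s : ℝ} (hs : 0 < s) (j : ℕ) : Integrable (gaussWeight s j) := by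
  have h := (integrable_rpow_mul_exp_neg_mul_sq (b := s ^ 2 / 2) (by positivity)
    (s := (j : ℝ)) (by have := j.cast_nonneg (α := ℝ); linarith)).norm
  refine h.congr (ae_of_all _ fun t => ?_)
  simp only [gaussWeight, Real.rpow_natCast, norm_mul, norm_pow, Real.norm_eq_abs, Real.abs_exp]
  congr 2; ring

/-- Rescaling t by s. With s = a, the factor a^(-(j+1)) is the price of a small bandwidth in the
stochastic error. -/
lemma integral_gaussWeight {s : ℝ} (hs : 0 < s) (j : ℕ) :
    ∫ t, gaussWeight s j t = (s ^ (j + 1))⁻¹ * ∫ t, gaussWeight 1 j t := by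
  have h := Measure.integral_comp_mul_left (gaussWeight 1 j) s
  have h2 : ∀ t, gaussWeight 1 j (s * t) = s ^ j * gaussWeight s j t := fun t => by
    simp only [gaussWeight, abs_mul, abs_of_pos hs, mul_pow, one_mul]; ring
  simp only [h2, integral_const_mul, abs_of_pos (inv_pos.2 hs), smul_eq_mul] at h
  have : s ≠ 0 := hs.ne'
  field_simp at h ⊢
  rw [← h]; ring

lemma norm_gaussDeriv_integrand (s : ℝ) (j : ℕ) (z t : ℝ) :
    ‖(Complex.I * t) ^ j * Complex.exp (Complex.I * t * z) *
      ((Real.exp (-(s * t) ^ 2 / 2) : ℝ) : ℂ)‖ = gaussWeight s j t := by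
  have : Complex.I * t * z = ((t * z : ℝ) : ℂ) * Complex.I := by push_cast; ring
  rw [this, norm_mul, norm_mul, Complex.norm_exp_ofReal_mul_I, norm_pow, norm_mul]
  simp [gaussWeight, -Complex.ofReal_exp, abs_of_pos (Real.exp_pos _)]

lemma continuous_gaussDeriv_integrand (s : ℝ) (j : ℕ) :
    Continuous fun p : ℝ × ℝ => (Complex.I * p.2) ^ j * Complex.exp (Complex.I * p.2 * p.1) *
      ((Real.exp (-(s * p.2) ^ 2 / 2) : ℝ) : ℂ) := by
  fun_prop

lemma integrable_gaussDeriv_integrand {s : ℝ} (hs : 0 < s) (j : ℕ) (z : ℝ) :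
    Integrable fun t : ℝ => (Complex.I * t) ^ j * Complex.exp (Complex.I * t * z) *
      ((Real.exp (-(s * t) ^ 2 / 2) : ℝ) : ℂ) :=
  (integrable_gaussWeight hs j).mono'
    ((continuous_gaussDeriv_integrand s j).comp (by fun_prop : Continuous fun t : ℝ => (z, t))
      ).aestronglyMeasurable
    (ae_of_all _ fun t => (norm_gaussDeriv_integrand s j z t).le)

/-- Differentiation under the integral sign brings down a factor it; the next weight dominates
uniformly in z. -/
lemma hasDerivAt_gaussDeriv {s : ℝ} (hs : 0 < s) (j : ℕ) (z : ℝ) :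
    HasDerivAt (gaussDeriv s j) (gaussDeriv s (j + 1) z) z := by
  refine HasDerivAt.const_mul _ (hasDerivAt_integral_of_dominated_loc_of_deriv_le
    (bound := gaussWeight s (j + 1)) (s := Set.univ) Filter.univ_mem
    (Filter.Eventually.of_forall fun y =>
      (integrable_gaussDeriv_integrand hs j y).aestronglyMeasurable)
    (integrable_gaussDeriv_integrand hs j z)
    (F' := fun (y t : ℝ) => (Complex.I * t) ^ (j + 1) * Complex.exp (Complex.I * t * y) *
      ((Real.exp (-(s * t) ^ 2 / 2) : ℝ) : ℂ))
    (integrable_gaussDeriv_integrand hs (j + 1) z).aestronglyMeasurable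
    (ae_of_all _ fun t y _ => (norm_gaussDeriv_integrand s (j + 1) y t).le)
    (integrable_gaussWeight hs (j + 1)) (ae_of_all _ fun t y _ => ?_)).2
  have h1 : HasDerivAt (fun y : ℝ => Complex.I * t * (y : ℂ)) (Complex.I * t) y := by
    simpa using (Complex.ofRealCLM.hasDerivAt (x := y)).const_mul (Complex.I * (t : ℂ))
  have h2 := ((h1.cexp).const_mul ((Complex.I * (t : ℂ)) ^ j)).mul_const
    ((Real.exp (-(s * t) ^ 2 / 2) : ℝ) : ℂ)
  exact h2.congr_deriv (by ring)

lemma norm_gaussDeriv_le (s : ℝ) (j : ℕ) (z : ℝ) :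
    ‖gaussDeriv s j z‖ ≤ (2 * Real.pi)⁻¹ * ∫ t, gaussWeight s j t := by
  have hπ : ‖(2 * Real.pi : ℂ)⁻¹‖ = (2 * Real.pi)⁻¹ := by
    simp [abs_of_pos Real.pi_pos]
  rw [gaussDeriv, norm_mul, hπ]
  gcongr
  refine (norm_integral_le_integral_norm _).trans_eq ?_
  simp only [norm_gaussDeriv_integrand]

lemma continuous_gaussDeriv {s : ℝ} (hs : 0 < s) (j : ℕ) : Continuous (gaussDeriv s j) :=
  continuous_iff_continuousAt.2 fun z => (hasDerivAt_gaussDeriv hs j z).continuousAt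

lemma integrable_gaussDeriv_sub {s : ℝ} (hs : 0 < s) (j : ℕ) (y : ℝ) (Q : Measure ℝ)
    [IsFiniteMeasure Q] : Integrable (fun x => gaussDeriv s j (y - x)) Q :=
  (integrable_const ((2 * Real.pi)⁻¹ * ∫ t, gaussWeight s j t)).mono'
    ((continuous_gaussDeriv hs j).comp (by fun_prop)).aestronglyMeasurable
    (ae_of_all _ fun _ => norm_gaussDeriv_le _ _ _)

lemma gaussDeriv_zero {s : ℝ} (hs : 0 < s) (z : ℝ) :
    gaussDeriv s 0 z = ((1 / s * kernel (z / s) : ℝ) : ℂ) := by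
  have h := fourierIntegral_gaussian (b := ((s ^ 2 / 2 : ℝ) : ℂ))
    (by rw [Complex.ofReal_re]; positivity) (z : ℂ)
  have e : ∀ t : ℝ, (Complex.I * t) ^ 0 * Complex.exp (Complex.I * t * z) *
      ((Real.exp (-(s * t) ^ 2 / 2) : ℝ) : ℂ) = Complex.exp (Complex.I * z * t) *
        Complex.exp (-((s ^ 2 / 2 : ℝ) : ℂ) * (t : ℂ) ^ 2) := fun t => by
    rw [pow_zero, one_mul, Complex.ofReal_exp]
    congr 2 <;> push_cast <;> ring
  rw [gaussDeriv]
  simp only [e]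
  rw [h]
  have e1 : ((Real.pi : ℂ) / ((s ^ 2 / 2 : ℝ) : ℂ)) ^ (1 / 2 : ℂ)
      = ((Real.sqrt (2 * Real.pi) / s : ℝ) : ℂ) := by
    rw [← Complex.ofReal_div, show (1 / 2 : ℂ) = ((1 / 2 : ℝ) : ℂ) by push_cast; rfl,
      ← Complex.ofReal_cpow (by positivity), ← Real.sqrt_eq_rpow,
      show Real.pi / (s ^ 2 / 2) = 2 * Real.pi / s ^ 2 by field_simp,
      Real.sqrt_div (by positivity), Real.sqrt_sq hs.le]
  have e2 : Complex.exp (-(z : ℂ) ^ 2 / (4 * ((s ^ 2 / 2 : ℝ) : ℂ)))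
      = ((Real.exp (-(z / s) ^ 2 / 2) : ℝ) : ℂ) := by
    rw [Complex.ofReal_exp]; congr 1; push_cast
    have : (s : ℂ) ≠ 0 := by exact_mod_cast hs.ne'
    field_simp; norm_num
  rw [e1, e2, show (2 * Real.pi : ℂ) = ((2 * Real.pi : ℝ) : ℂ) by push_cast; rfl,
    ← Complex.ofReal_inv, ← Complex.ofReal_mul, ← Complex.ofReal_mul, kernel]
  congr 1
  have hq : Real.sqrt (2 * Real.pi) ≠ 0 := by positivity
  have h2 : (2 * Real.pi) = Real.sqrt (2 * Real.pi) * Real.sqrt (2 * Real.pi) :=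
    (Real.mul_self_sqrt (by positivity)).symm
  rw [h2]
  simp only [Real.sqrt_mul_self (Real.sqrt_nonneg _)]
  field_simp

lemma one_div_mul_kernel (σ : ℝ≥0) (z : ℝ) :
    1 / (σ : ℝ) * kernel (z / σ) = gaussianPDFReal 0 (σ ^ 2) z := by
  rw [kernel, gaussianPDFReal]
  simp only [NNReal.coe_pow, sub_zero]
  rw [Real.sqrt_mul (x := 2 * Real.pi) (by positivity), Real.sqrt_sq σ.coe_nonneg, mul_inv, ← mul_assoc]
  congr 1
  · rw [one_div, one_div, mul_comm]
  · congr 1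
    rw [div_pow, neg_div, neg_div, div_div, mul_comm (2 : ℝ)]

/-- A sequence of complex functions, each the derivative of the previous one, that starts with a
real function consists of the iterated derivatives of that function. -/
lemma iteratedDeriv_ofReal_eq {f : ℝ → ℝ} {g : ℕ → ℝ → ℂ} (h0 : ∀ y, g 0 y = f y)
    (hg : ∀ j y, HasDerivAt (g j) (g (j + 1) y) y) (j : ℕ) (y : ℝ) :
    ((iteratedDeriv j f y : ℝ) : ℂ) = g j y := by
  induction j generalizing y with
  | zero => simp [h0]
  | succ j ih =>
    have hre : HasDerivAt (iteratedDeriv j f) (g (j + 1) y).re y := by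
      have := Complex.reCLM.hasFDerivAt.comp_hasDerivAt y (hg j y)
      refine this.congr_of_eventuallyEq (Filter.Eventually.of_forall fun x => ?_)
      simp [← ih]
    -- The imaginary part of `g j` vanishes identically, so uniqueness of derivatives forces that of
    -- `g (j + 1)` to vanish.
    have him : HasDerivAt (fun _ : ℝ => (0 : ℝ)) (g (j + 1) y).im y := by
      have := Complex.imCLM.hasFDerivAt.comp_hasDerivAt y (hg j y)
      refine this.congr_of_eventuallyEq (Filter.Eventually.of_forall fun x => ?_)
      simp [← ih]
    rw [iteratedDeriv_succ, hre.deriv]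
    apply Complex.ext
    · simp
    · simpa using (hasDerivAt_const y (0 : ℝ)).unique him

lemma iteratedDeriv_eq_of_hasDerivAt_succ {g : ℕ → ℝ → ℂ}
    (hg : ∀ j y, HasDerivAt (g j) (g (j + 1) y) y) (j : ℕ) : iteratedDeriv j (g 0) = g j := by
  induction j with
  | zero => simp
  | succ j ih => rw [iteratedDeriv_succ, ih]; exact funext fun y => (hg j y).deriv

/-! ### Kernel estimates and their targets in Fourier form -/

lemma kdeDeriv_eq {a : ℝ} (ha : 0 < a) {n : ℕ} (s : Fin n → ℝ) (j : ℕ) (y : ℝ) :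
    (kdeDeriv j a s y : ℂ) = 1 / (n : ℂ) * ∑ i, gaussDeriv a j (y - s i) := by
  refine iteratedDeriv_ofReal_eq (f := kde a s)
    (g := fun j y => 1 / (n : ℂ) * ∑ i, gaussDeriv a j (y - s i)) (fun y => ?_)
    (fun j y => ?_) j y
  · simp only [gaussDeriv_zero ha, kde]; push_cast; rfl
  · refine HasDerivAt.const_mul _ (HasDerivAt.fun_sum fun i _ => ?_)
    simpa using (hasDerivAt_gaussDeriv ha j (y - s i)).comp_sub_const y (s i)

lemma kdeDeriv_zero (a : ℝ) {n : ℕ} (s : Fin n → ℝ) (y : ℝ) :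
    kdeDeriv 0 a s y = kde a s y := by
  simp [kdeDeriv]

/-- The `j`-th derivative of the convolution of `Q` with the centred Gaussian law with standard
deviation `s`. -/
def smoothDeriv (Q : Measure ℝ) (s : ℝ) (j : ℕ) (y : ℝ) : ℂ :=
  ∫ x, gaussDeriv s j (y - x) ∂Q

/-- Fubini: integrating exp(-itx) over `Q` produces the characteristic function at -t. -/
lemma smoothDeriv_eq (Q : Measure ℝ) [IsFiniteMeasure Q] {s : ℝ} (hs : 0 < s) (j : ℕ) (y : ℝ) :
    smoothDeriv Q s j y = (2 * Real.pi : ℂ)⁻¹ * ∫ t : ℝ, (Complex.I * t) ^ j *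
      Complex.exp (Complex.I * t * y) * (charFun Q (-t) * (Real.exp (-(s * t) ^ 2 / 2) : ℝ)) := by
  rw [smoothDeriv]
  simp only [gaussDeriv]
  rw [integral_const_mul, integral_integral_swap]
  · congr 1
    refine integral_congr_ae (ae_of_all _ fun t => ?_)
    simp only [charFun_apply_real]
    rw [← integral_mul_const, ← integral_const_mul]
    refine integral_congr_ae (ae_of_all _ fun x => ?_)
    simp only
    rw [show Complex.I * t * ((y - x : ℝ) : ℂ) =
      Complex.I * t * y + ((-t : ℝ) : ℂ) * x * Complex.I by push_cast; ring, Complex.exp_add]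
    ring
  · have hc : Continuous (Function.uncurry fun x t : ℝ => (Complex.I * t) ^ j *
        Complex.exp (Complex.I * t * ((y - x : ℝ) : ℂ)) *
        ((Real.exp (-(s * t) ^ 2 / 2) : ℝ) : ℂ)) :=
      (continuous_gaussDeriv_integrand s j).comp
        (by fun_prop : Continuous fun p : ℝ × ℝ => (y - p.1, p.2))
    refine ((integrable_gaussWeight hs j).comp_snd Q).mono' hc.aestronglyMeasurable
      (ae_of_all _ fun p => ?_)
    exact (norm_gaussDeriv_integrand s j (y - p.1) p.2).le

lemma norm_smoothDeriv_le (Q : Measure ℝ) [IsProbabilityMeasure Q] (s : ℝ) (j : ℕ) (y : ℝ) :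
    ‖smoothDeriv Q s j y‖ ≤ (2 * Real.pi)⁻¹ * ∫ t, gaussWeight s j t := by
  have h := norm_integral_le_of_norm_le_const (μ := Q)
    (ae_of_all _ fun x => norm_gaussDeriv_le s j (y - x))
  simpa [smoothDeriv] using h

lemma smoothDeriv_zero (Q : Measure ℝ) {σ : ℝ≥0} (hσ : 0 < σ) (y : ℝ) :
    smoothDeriv Q σ 0 y = (outputDensity Q σ y : ℂ) := by
  simp only [smoothDeriv, gaussDeriv_zero (NNReal.coe_pos.2 hσ), one_div_mul_kernel, outputDensity]
  exact integral_ofReal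

/-- The empirical characteristic function of `s`, at `-t`. -/
def empiricalCharFun {n : ℕ} (s : Fin n → ℝ) (t : ℝ) : ℂ :=
  1 / (n : ℂ) * ∑ i, Complex.exp (((-t * s i : ℝ) : ℂ) * Complex.I)

/-- The characteristic function of `Y = X + N` at `-t`, where `X` has law `Q`. -/
def outputCharFun (Q : Measure ℝ) (σ : ℝ) (t : ℝ) : ℂ :=
  charFun Q (-t) * (Real.exp (-(σ * t) ^ 2 / 2) : ℝ)

lemma norm_empiricalCharFun_le {n : ℕ} (hn : 0 < n) (s : Fin n → ℝ) (t : ℝ) :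
    ‖empiricalCharFun s t‖ ≤ 1 := by
  have hn' : (0 : ℝ) < n := by exact_mod_cast hn
  rw [empiricalCharFun, norm_mul]
  have h : ‖∑ i, Complex.exp (((-t * s i : ℝ) : ℂ) * Complex.I)‖ ≤ n := by
    refine (norm_sum_le _ _).trans ?_
    simp only [Complex.norm_exp_ofReal_mul_I]
    simp
  calc _ ≤ ‖1 / (n : ℂ)‖ * n := by gcongr
    _ = 1 := by simp [hn'.ne']

lemma exp_neg_sq_div_two_le_one (x : ℝ) : Real.exp (-x ^ 2 / 2) ≤ 1 :=
  Real.exp_le_one_iff.2 (by nlinarith [sq_nonneg x])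

lemma norm_outputCharFun_le (Q : Measure ℝ) [IsProbabilityMeasure Q] (σ t : ℝ) :
    ‖outputCharFun Q σ t‖ ≤ 1 := by
  rw [outputCharFun, norm_mul, Complex.norm_real, Real.norm_eq_abs, Real.abs_exp]
  exact mul_le_one₀ (norm_charFun_le_one _) (Real.exp_pos _).le (exp_neg_sq_div_two_le_one _)

lemma continuous_empiricalCharFun {n : ℕ} (s : Fin n → ℝ) : Continuous (empiricalCharFun s) := by
  unfold empiricalCharFun; fun_prop

lemma continuous_outputCharFun (Q : Measure ℝ) [IsProbabilityMeasure Q] (σ : ℝ) :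
    Continuous (outputCharFun Q σ) := by
  unfold outputCharFun
  exact (continuous_charFun.comp continuous_neg).mul (by fun_prop)

lemma kdeDeriv_eq_integral {a : ℝ} (ha : 0 < a) {n : ℕ} (s : Fin n → ℝ) (j : ℕ) (y : ℝ) :
    (kdeDeriv j a s y : ℂ) = (2 * Real.pi : ℂ)⁻¹ * ∫ t : ℝ, (Complex.I * t) ^ j *
      Complex.exp (Complex.I * t * y) *
        (empiricalCharFun s t * (Real.exp (-(a * t) ^ 2 / 2) : ℝ)) := by
  rw [kdeDeriv_eq ha]
  simp only [gaussDeriv]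
  rw [← Finset.mul_sum, ← integral_finsetSum _
    fun i _ => integrable_gaussDeriv_integrand ha j (y - s i), mul_left_comm, ← integral_const_mul]
  congr 1
  refine integral_congr_ae (ae_of_all _ fun t => ?_)
  simp only [empiricalCharFun, Finset.mul_sum, Finset.sum_mul]
  refine Finset.sum_congr rfl fun i _ => ?_
  rw [show Complex.I * t * ((y - s i : ℝ) : ℂ) =
      Complex.I * t * y + ((-t * s i : ℝ) : ℂ) * Complex.I by push_cast; ring, Complex.exp_add]
  ring

/-- A bound, uniform in the point, on the error of the estimators of the derivatives of `f_Y`. -/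
lemma norm_kdeDeriv_sub_le (Q : Measure ℝ) [IsProbabilityMeasure Q] {σ a : ℝ} (hσ : 0 < σ)
    (ha : 0 < a) {n : ℕ} (hn : 0 < n) (s : Fin n → ℝ) (j : ℕ) (y : ℝ) :
    ‖(kdeDeriv j a s y : ℂ) - smoothDeriv Q σ j y‖ ≤
      (∫ t, gaussWeight a j t * ‖empiricalCharFun s t - outputCharFun Q σ t‖) +
        a ^ 2 * ∫ t, gaussWeight σ (j + 2) t := by
  have hc : Continuous fun t : ℝ => (Complex.I * t) ^ j * Complex.exp (Complex.I * t * y) := by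
    fun_prop
  have hnorm : ∀ t : ℝ, ‖(Complex.I * t) ^ j * Complex.exp (Complex.I * t * y)‖ = |t| ^ j :=
    fun t => by
      have := norm_gaussDeriv_integrand 0 j y t
      simpa [gaussWeight] using this
  have hφ : Continuous fun t : ℝ => charFun Q (-t) := continuous_charFun.comp continuous_neg
  have i1 : Integrable fun t : ℝ => (Complex.I * t) ^ j * Complex.exp (Complex.I * t * y) *
      (empiricalCharFun s t * (Real.exp (-(a * t) ^ 2 / 2) : ℝ)) := by
    refine (integrable_gaussWeight ha j).mono' (hc.mul ((continuous_empiricalCharFun s).mul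
      (by fun_prop))).aestronglyMeasurable (ae_of_all _ fun t => ?_)
    rw [norm_mul, hnorm, norm_mul, Complex.norm_real, Real.norm_eq_abs, Real.abs_exp, gaussWeight]
    gcongr
    exact mul_le_of_le_one_left (Real.exp_pos _).le (norm_empiricalCharFun_le hn s t)
  have i2 : Integrable fun t : ℝ => (Complex.I * t) ^ j * Complex.exp (Complex.I * t * y) *
      (charFun Q (-t) * (Real.exp (-(σ * t) ^ 2 / 2) : ℝ)) := by
    refine (integrable_gaussWeight hσ j).mono' (hc.mul (hφ.mul
      (by fun_prop))).aestronglyMeasurable (ae_of_all _ fun t => ?_)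
    rw [norm_mul, hnorm, norm_mul, Complex.norm_real, Real.norm_eq_abs, Real.abs_exp, gaussWeight]
    gcongr
    exact mul_le_of_le_one_left (Real.exp_pos _).le (norm_charFun_le_one _)
  have i3 : Integrable fun t : ℝ =>
      gaussWeight a j t * ‖empiricalCharFun s t - outputCharFun Q σ t‖ := by
    refine ((integrable_gaussWeight ha j).mul_const 2).mono' ((continuous_gaussWeight a j).mul
      ((continuous_empiricalCharFun s).sub (continuous_outputCharFun Q σ)).norm
        ).aestronglyMeasurable (ae_of_all _ fun t => ?_)
    rw [norm_mul, norm_norm, Real.norm_of_nonneg (gaussWeight_nonneg _ _ _)]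
    gcongr
    · exact gaussWeight_nonneg _ _ _
    · refine (norm_sub_le _ _).trans ?_
      linarith [norm_empiricalCharFun_le hn s t, norm_outputCharFun_le Q σ t]
  have i4 : Integrable fun t : ℝ => a ^ 2 * gaussWeight σ (j + 2) t :=
    (integrable_gaussWeight hσ _).const_mul _
  have hπ : ‖(2 * Real.pi : ℂ)⁻¹‖ ≤ 1 := by
    rw [norm_inv]
    refine inv_le_one_of_one_le₀ ?_
    simp only [norm_mul, Complex.norm_ofNat, Complex.norm_real, Real.norm_eq_abs,
      abs_of_pos Real.pi_pos]
    linarith [Real.pi_gt_three]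
  rw [kdeDeriv_eq_integral ha, smoothDeriv_eq Q hσ, ← mul_sub, ← integral_sub i1 i2,
    ← integral_const_mul (a ^ 2), ← integral_add i3 i4, norm_mul]
  refine (mul_le_of_le_one_left (norm_nonneg _) hπ).trans
    (norm_integral_le_of_norm_le (i3.add i4) (ae_of_all _ fun t => ?_))
  have hx : 1 - Real.exp (-(a * t) ^ 2 / 2) ≤ a ^ 2 * t ^ 2 := by
    have := Real.add_one_le_exp (-(a * t) ^ 2 / 2)
    nlinarith [sq_nonneg (a * t)]
  -- Stochastic error damped by the kernel, minus bias; the last bracket is zero. In the bias, the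
  -- Gaussian decay of `outputCharFun` makes t² integrable, which leaves a² times a constant.
  have hsplit : empiricalCharFun s t * (Real.exp (-(a * t) ^ 2 / 2) : ℝ) -
      charFun Q (-t) * (Real.exp (-(σ * t) ^ 2 / 2) : ℝ) =
      (empiricalCharFun s t - outputCharFun Q σ t) * (Real.exp (-(a * t) ^ 2 / 2) : ℝ) -
      outputCharFun Q σ t * ((1 - Real.exp (-(a * t) ^ 2 / 2) : ℝ) : ℂ) +
      (outputCharFun Q σ t - charFun Q (-t) * (Real.exp (-(σ * t) ^ 2 / 2) : ℝ)) := by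
    push_cast; ring
  have hσ' : ‖outputCharFun Q σ t‖ ≤ Real.exp (-(σ * t) ^ 2 / 2) := by
    rw [outputCharFun, norm_mul, Complex.norm_real, Real.norm_eq_abs, Real.abs_exp]
    exact mul_le_of_le_one_left (Real.exp_pos _).le (norm_charFun_le_one _)
  rw [← mul_sub, hsplit, norm_mul, hnorm, outputCharFun, sub_self, add_zero, ← outputCharFun]
  calc _ ≤ |t| ^ j * (‖empiricalCharFun s t - outputCharFun Q σ t‖ *
        Real.exp (-(a * t) ^ 2 / 2) + Real.exp (-(σ * t) ^ 2 / 2) * (a ^ 2 * t ^ 2)) := by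
        gcongr
        refine (norm_sub_le _ _).trans ?_
        rw [norm_mul, norm_mul, Complex.norm_real, Complex.norm_real, Real.norm_eq_abs,
          Real.abs_exp, Real.norm_of_nonneg (sub_nonneg.2 (exp_neg_sq_div_two_le_one _))]
        gcongr
        exact sub_nonneg.2 (exp_neg_sq_div_two_le_one _)
    _ = _ := by
        simp only [gaussWeight, pow_add, sq_abs]
        ring

/-! ### Concentration of the empirical characteristic function -/

section Probability

variable {Ω : Type*} [MeasurableSpace Ω] {P : Measure Ω} [IsProbabilityMeasure P]

/-- The mean absolute error of the empirical mean of bounded i.i.d. variables. -/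
lemma lintegral_enorm_empiricalMean_sub_le {Y : ℕ → Ω → ℝ} (hY : iIndepFun Y P)
    (hm : ∀ i, AEMeasurable (Y i) P) {g : ℝ → ℝ} (hg : Measurable g) (hb : ∀ x, |g x| ≤ 1)
    {c : ℝ} (hc : ∀ i, ∫ ω, g (Y i ω) ∂P = c) {n : ℕ} (hn : 0 < n) :
    ∫⁻ ω, ‖1 / (n : ℝ) * ∑ i : Fin n, g (Y i ω) - c‖ₑ ∂P ≤ ENNReal.ofReal (1 / √n) := by
  have hn' : (0 : ℝ) < n := by exact_mod_cast hn
  have hL : ∀ i : Fin n, MemLp (fun ω => g (Y i ω)) 2 P := fun i =>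
    MemLp.of_bound (hg.comp_aemeasurable (hm i)).aestronglyMeasurable 1
      (ae_of_all _ fun ω => hb _)
  set S : Ω → ℝ := ∑ i : Fin n, fun ω => g (Y i ω) with hS
  have hSapp : ∀ ω, S ω = ∑ i : Fin n, g (Y i ω) := fun ω => by simp [hS]
  have hSL : MemLp S 2 P := memLp_finsetSum' _ fun i _ => hL i
  have hSint : ∫ ω, S ω ∂P = n * c := by
    simp only [hSapp]
    rw [integral_finsetSum _ fun i _ => (hL i).integrable (by norm_num)]
    simp [hc]
  have hvar : Var[S; P] ≤ n := by
    rw [hS, IndepFun.variance_sum (fun i _ => hL i)]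
    · calc _ ≤ ∑ i : Fin n, (1 : ℝ) := Finset.sum_le_sum fun i _ => by
            refine (variance_le_expectation_sq (hL i).aestronglyMeasurable).trans ?_
            refine (integral_mono_of_nonneg (ae_of_all _ fun ω => sq_nonneg _)
              (integrable_const (1 : ℝ)) (ae_of_all _ fun ω => ?_)).trans (by simp)
            simpa using (sq_le_one_iff_abs_le_one _).2 (hb (Y i ω))
        _ = n := by simp
    · intro i _ j _ hij
      exact (hY.indepFun (fun h => hij (Fin.ext h))).comp hg hg
  rw [variance_eq_integral hSL.aemeasurable, hSint] at hvar
  have hsq : Integrable (fun ω => (S ω - n * c) ^ 2) P :=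
    (hSL.sub (memLp_const (n * c))).integrable_sq
  have hr : 0 < √(n : ℝ) := Real.sqrt_pos.2 hn'
  have hrr : √(n : ℝ) * √n = n := Real.mul_self_sqrt hn'.le
  -- AM-GM in the form z/n ≤ z²/(2n√n) + 1/(2√n), balanced at z = √n, the size of the standard
  -- deviation of the sum; it passes from the variance to the mean absolute error.
  have hpt : ∀ ω, |1 / (n : ℝ) * ∑ i : Fin n, g (Y i ω) - c| ≤
      (S ω - n * c) ^ 2 * (1 / (2 * n * √n)) + 1 / (2 * √n) := fun ω => by
    rw [← hSapp]
    have e : 1 / (n : ℝ) * S ω - c = (S ω - n * c) / n := by field_simp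
    rw [e, abs_div, abs_of_pos hn', ← sq_abs (S ω - n * c)]
    set z := |S ω - n * c|
    have key : (z ^ 2 * (1 / (2 * n * √n)) + 1 / (2 * √n)) - z / n =
        (z - √n) ^ 2 / (2 * n * √n) := by
      field_simp
      linear_combination -hrr
    have : 0 ≤ (z - √n) ^ 2 / (2 * n * √n) := by positivity
    linarith
  have hint : Integrable (fun ω => (S ω - n * c) ^ 2 * (1 / (2 * n * √n)) + 1 / (2 * √n)) P :=
    (hsq.mul_const _).add (integrable_const _)
  calc _ ≤ ∫⁻ ω, ENNReal.ofReal ((S ω - n * c) ^ 2 * (1 / (2 * n * √n)) + 1 / (2 * √n)) ∂P := by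
        refine lintegral_mono fun ω => ?_
        rw [Real.enorm_eq_ofReal_abs]
        exact ENNReal.ofReal_le_ofReal (hpt ω)
    _ = ENNReal.ofReal (∫ ω, (S ω - n * c) ^ 2 * (1 / (2 * n * √n)) + 1 / (2 * √n) ∂P) :=
        (ofReal_integral_eq_lintegral_ofReal hint (ae_of_all _ fun ω => by
          simp only [Pi.zero_apply]; positivity)).symm
    _ ≤ _ := by
        refine ENNReal.ofReal_le_ofReal ?_
        rw [integral_add (hsq.mul_const _) (integrable_const _), integral_mul_const]
        simp only [integral_const, probReal_univ, smul_eq_mul, one_mul]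
        calc _ ≤ (n : ℝ) * (1 / (2 * n * √n)) + 1 / (2 * √n) := by gcongr
          _ = _ := by field_simp; norm_num

lemma charFun_map_eq_outputCharFun {X N Z : Ω → ℝ} {σ : ℝ≥0} (hX : AEMeasurable X P)
    (hN : HasLaw N (gaussianReal 0 (σ ^ 2)) P) (hXN : IndepFun X N P)
    (hZ : IdentDistrib Z (fun ω => X ω + N ω) P P) (t : ℝ) :
    ∫ ω, Complex.exp (((-t * Z ω : ℝ) : ℂ) * Complex.I) ∂P = outputCharFun (P.map X) σ t := by
  have h1 := congrFun (hXN.charFun_map_add_eq_mul hX hN.aemeasurable) (-t)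
  rw [Pi.mul_apply, hN.map_eq, charFun_gaussianReal,
    show P.map (X + N) = P.map Z from hZ.map_eq.symm, charFun_apply_real,
    integral_map hZ.aemeasurable_fst (by fun_prop)] at h1
  rw [outputCharFun]
  convert h1 using 2
  · push_cast; rfl
  · push_cast; congr 1; ring

variable {X N : Ω → ℝ} {Y : ℕ → Ω → ℝ} {σ : ℝ≥0}

/-- The real and imaginary parts are empirical means of a cosine and a sine, each contributing 1/√n.
-/
lemma lintegral_enorm_empiricalCharFun_sub_le (hX : AEMeasurable X P)
    (hN : HasLaw N (gaussianReal 0 (σ ^ 2)) P) (hXN : IndepFun X N P) (hY : iIndepFun Y P)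
    (hYd : ∀ i, IdentDistrib (Y i) (fun ω => X ω + N ω) P P) {n : ℕ} (hn : 0 < n) (t : ℝ) :
    ∫⁻ ω, ‖empiricalCharFun (fun i : Fin n => Y i ω) t - outputCharFun (P.map X) σ t‖ₑ ∂P ≤
      ENNReal.ofReal (2 / √n) := by
  have hm : ∀ i, AEMeasurable (Y i) P := fun i => (hYd i).aemeasurable_fst
  have hint : ∀ i, Integrable (fun ω => Complex.exp (((-t * Y i ω : ℝ) : ℂ) * Complex.I)) P :=
    fun i => (integrable_const (1 : ℝ)).mono' (by
      have := hm i
      exact AEMeasurable.aestronglyMeasurable (by fun_prop))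
      (ae_of_all _ fun ω => (Complex.norm_exp_ofReal_mul_I _).le)
  have hcos : ∀ i, ∫ ω, Real.cos (-t * Y i ω) ∂P = (outputCharFun (P.map X) σ t).re := fun i => by
    rw [← charFun_map_eq_outputCharFun hX hN hXN (hYd i) t]
    rw [show (∫ ω, Complex.exp (((-t * Y i ω : ℝ) : ℂ) * Complex.I) ∂P).re =
      ∫ ω, (Complex.exp (((-t * Y i ω : ℝ) : ℂ) * Complex.I)).re ∂P from
        (integral_re (hint i)).symm]
    simp only [Complex.exp_ofReal_mul_I_re]
  have hsin : ∀ i, ∫ ω, Real.sin (-t * Y i ω) ∂P = (outputCharFun (P.map X) σ t).im := fun i => by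
    rw [← charFun_map_eq_outputCharFun hX hN hXN (hYd i) t]
    rw [show (∫ ω, Complex.exp (((-t * Y i ω : ℝ) : ℂ) * Complex.I) ∂P).im =
      ∫ ω, (Complex.exp (((-t * Y i ω : ℝ) : ℂ) * Complex.I)).im ∂P from
        (integral_im (hint i)).symm]
    simp only [Complex.exp_ofReal_mul_I_im]
  have b1 := lintegral_enorm_empiricalMean_sub_le hY hm (g := fun x => Real.cos (-t * x))
    (by fun_prop) (fun x => Real.abs_cos_le_one _) hcos hn
  have b2 := lintegral_enorm_empiricalMean_sub_le hY hm (g := fun x => Real.sin (-t * x))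
    (by fun_prop) (fun x => Real.abs_sin_le_one _) hsin hn
  have e : ∀ s : Fin n → ℝ, empiricalCharFun s t =
      ((1 / (n : ℝ) * ∑ i, Real.cos (-t * s i) : ℝ) : ℂ) +
        ((1 / (n : ℝ) * ∑ i, Real.sin (-t * s i) : ℝ) : ℂ) * Complex.I := fun s => by
    rw [empiricalCharFun]
    simp only [Complex.exp_mul_I, ← Complex.ofReal_cos, ← Complex.ofReal_sin]
    rw [Finset.sum_add_distrib, ← Finset.sum_mul]
    push_cast; ring
  calc _ ≤ ∫⁻ ω, ‖1 / (n : ℝ) * ∑ i : Fin n, Real.cos (-t * Y i ω) -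
            (outputCharFun (P.map X) σ t).re‖ₑ +
          ‖1 / (n : ℝ) * ∑ i : Fin n, Real.sin (-t * Y i ω) -
            (outputCharFun (P.map X) σ t).im‖ₑ ∂P := by
        refine lintegral_mono fun ω => ?_
        simp only [← ofReal_norm]
        rw [← ENNReal.ofReal_add (norm_nonneg _) (norm_nonneg _)]
        refine ENNReal.ofReal_le_ofReal ((Complex.norm_le_abs_re_add_abs_im _).trans_eq ?_)
        simp only [e, Real.norm_eq_abs, Complex.sub_re, Complex.sub_im, Complex.add_re,
          Complex.add_im, Complex.ofReal_re, Complex.ofReal_im, Complex.re_ofReal_mul,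
          Complex.im_ofReal_mul, Complex.I_re, Complex.I_im, mul_zero, mul_one, add_zero, zero_add]
    _ = _ := lintegral_add_left' (by
        have := hm
        refine AEMeasurable.enorm ?_
        fun_prop) _
    _ ≤ _ := add_le_add b1 b2
    _ = _ := by
        rw [← ENNReal.ofReal_add (by positivity) (by positivity)]
        congr 1; ring

/-- The estimators of the derivatives of `f_Y` up to order `k` are uniformly close to their
targets, outside an event of small probability. -/
lemma measure_exists_kdeDeriv_sub_gt_le (hσ : 0 < σ) (hX : AEMeasurable X P)
    (hN : HasLaw N (gaussianReal 0 (σ ^ 2)) P) (hXN : IndepFun X N P) (hY : iIndepFun Y P)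
    (hYd : ∀ i, IdentDistrib (Y i) (fun ω => X ω + N ω) P P) {n : ℕ} (hn : 0 < n) {a ε : ℝ}
    (ha : 0 < a) (hε : 0 < ε) (k : ℕ)
    (hbias : ∀ j ≤ k, a ^ 2 * ∫ t, gaussWeight σ (j + 2) t ≤ ε / 2) :
    P {ω | ∃ j ≤ k, ∃ y, ε < ‖(kdeDeriv j a (fun i : Fin n => Y i ω) y : ℂ) -
      smoothDeriv (P.map X) σ j y‖} ≤ ∑ j ∈ Finset.range (k + 1),
        ENNReal.ofReal (4 * (∫ t, gaussWeight 1 j t) / (√n * a ^ (j + 1) * ε)) := by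
  have : IsProbabilityMeasure (P.map X) := Measure.isProbabilityMeasure_map hX
  have hn' : (0 : ℝ) < n := by exact_mod_cast hn
  have hr : 0 < √(n : ℝ) := Real.sqrt_pos.2 hn'
  have hm : ∀ i, AEMeasurable (Y i) P := fun i => (hYd i).aemeasurable_fst
  set G : ℝ → Ω → ℝ≥0∞ := fun t ω =>
    ‖empiricalCharFun (fun i : Fin n => Y i ω) t - outputCharFun (P.map X) σ t‖ₑ with hG
  set D : ℕ → Ω → ℝ≥0∞ := fun j ω => ∫⁻ t, ENNReal.ofReal (gaussWeight a j t) * G t ω with hD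
  have hmeas : ∀ j, AEMeasurable
      (Function.uncurry fun (ω : Ω) (t : ℝ) => ENNReal.ofReal (gaussWeight a j t) * G t ω)
      (P.prod volume) := fun j => by
    have h1 : ∀ i, AEMeasurable (fun p : Ω × ℝ => Y i p.1) (P.prod volume) := fun i =>
      (hm i).comp_fst
    have h2 : Measurable fun p : Ω × ℝ => outputCharFun (P.map X) σ p.2 :=
      (continuous_outputCharFun (P.map X) σ).measurable.comp measurable_snd
    have h3 : Measurable fun p : Ω × ℝ => gaussWeight a j p.2 :=
      (continuous_gaussWeight a j).measurable.comp measurable_snd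
    simp only [Function.uncurry_def, hG]
    refine h3.ennreal_ofReal.aemeasurable.mul (AEMeasurable.enorm (AEMeasurable.sub ?_
      h2.aemeasurable))
    unfold empiricalCharFun
    fun_prop
  have hDm : ∀ j, AEMeasurable (D j) P := fun j => (hmeas j).lintegral_prod_right'
  have hDint : ∀ j, ∫⁻ ω, D j ω ∂P ≤
      ENNReal.ofReal (2 / √n * ((a ^ (j + 1))⁻¹ * ∫ t, gaussWeight 1 j t)) := fun j => by
    rw [hD]
    rw [lintegral_lintegral_swap (hmeas j), ← integral_gaussWeight ha j,
      ENNReal.ofReal_mul (by positivity), ofReal_integral_eq_lintegral_ofReal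
        (integrable_gaussWeight ha j) (ae_of_all _ fun t => gaussWeight_nonneg _ _ _),
      ← lintegral_const_mul' _ _ ENNReal.ofReal_ne_top]
    refine lintegral_mono fun t => ?_
    simp only
    rw [lintegral_const_mul' _ _ ENNReal.ofReal_ne_top, mul_comm]
    gcongr
    exact lintegral_enorm_empiricalCharFun_sub_le hX hN hXN hY hYd hn t
  -- The Fourier bound does not depend on y, so the uncountable union over y collapses into k + 1
  -- events to which Markov applies. The bias uses up half of ε.
  have hsub : {ω | ∃ j ≤ k, ∃ y, ε < ‖(kdeDeriv j a (fun i : Fin n => Y i ω) y : ℂ) -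
      smoothDeriv (P.map X) σ j y‖} ⊆
      ⋃ j ∈ Finset.range (k + 1), {ω | ENNReal.ofReal (ε / 2) ≤ D j ω} := by
    rintro ω ⟨j, hj, y, hy⟩
    simp only [Set.mem_iUnion, Finset.mem_range, Set.mem_ofPred_eq]
    refine ⟨j, by omega, ?_⟩
    have h := norm_kdeDeriv_sub_le (P.map X) (NNReal.coe_pos.2 hσ) ha hn
      (fun i : Fin n => Y i ω) j y
    have h' := hbias j hj
    have hlow : ε / 2 ≤ ∫ t, gaussWeight a j t *
        ‖empiricalCharFun (fun i : Fin n => Y i ω) t - outputCharFun (P.map X) σ t‖ := by linarith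
    refine (ENNReal.ofReal_le_ofReal hlow).trans ?_
    refine (ENNReal.ofReal_le_ofReal (le_abs_self _)).trans ?_
    rw [← Real.enorm_eq_ofReal_abs]
    refine (enorm_integral_le_lintegral_enorm _).trans_eq ?_
    refine lintegral_congr fun t => ?_
    rw [enorm_mul, enorm_norm, Real.enorm_of_nonneg (gaussWeight_nonneg _ _ _)]
  refine (measure_mono hsub).trans ((measure_biUnion_finset_le _ _).trans
    (Finset.sum_le_sum fun j _ => ?_))
  have hε2 : ENNReal.ofReal (ε / 2) ≠ 0 := by
    rw [Ne, ENNReal.ofReal_eq_zero, not_le]; positivity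
  refine (meas_ge_le_lintegral_div (hDm j) hε2 ENNReal.ofReal_ne_top).trans ?_
  refine (ENNReal.div_le_div_right (hDint j) _).trans_eq ?_
  rw [← ENNReal.ofReal_div_of_pos (by positivity)]
  congr 1
  field_simp
  ring

end Probability

/-! ### The Hermite identity for conditional moments -/

/-- The coefficient `(-i)^m σ^{-m} He_m(i y / σ)` of the estimator. -/
def hermiteCoeff (σ : ℝ) (m : ℕ) (y : ℝ) : ℂ :=
  ((-Complex.I) ^ m / (σ : ℂ) ^ m) *
    Polynomial.aeval (Complex.I * ((y / σ : ℝ) : ℂ)) (Polynomial.hermite m)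

/-- The recurrence He_{m+1}(x) = x He_m(x) - He_m'(x) at x = iy/σ. Hence `hermiteCoeff σ m` times
exp(y²/(2σ²)) is the m-th derivative of that exponential. -/
lemma hasDerivAt_hermiteCoeff_mul_exp {σ : ℝ} (hσ : 0 < σ) (m : ℕ) (y : ℝ) :
    HasDerivAt (fun y : ℝ => hermiteCoeff σ m y * Complex.exp ((y : ℂ) ^ 2 / (2 * (σ : ℂ) ^ 2)))
      (hermiteCoeff σ (m + 1) y * Complex.exp ((y : ℂ) ^ 2 / (2 * (σ : ℂ) ^ 2))) y := by
  have hσ' : (σ : ℂ) ≠ 0 := by exact_mod_cast hσ.ne'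
  have hid : HasDerivAt (fun y : ℝ => (y : ℂ)) 1 y := Complex.ofRealCLM.hasDerivAt
  have hlin : HasDerivAt (fun y : ℝ => Complex.I * ((y / σ : ℝ) : ℂ)) (Complex.I / σ) y := by
    have := (hid.div_const (σ : ℂ)).const_mul Complex.I
    simpa [mul_div_assoc, div_eq_mul_inv] using this
  have hp : HasDerivAt (fun y : ℝ => Polynomial.aeval (Complex.I * ((y / σ : ℝ) : ℂ))
      (Polynomial.hermite m)) (Polynomial.aeval (Complex.I * ((y / σ : ℝ) : ℂ))
        (Polynomial.derivative (Polynomial.hermite m)) * (Complex.I / σ)) y :=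
    HasDerivAt.comp (h₂ := fun z : ℂ => Polynomial.aeval z (Polynomial.hermite m)) y
      ((Polynomial.hermite m).hasDerivAt_aeval (Complex.I * ((y / σ : ℝ) : ℂ))) hlin
  have hq : HasDerivAt (fun y : ℝ => Complex.exp ((y : ℂ) ^ 2 / (2 * (σ : ℂ) ^ 2)))
      (Complex.exp ((y : ℂ) ^ 2 / (2 * (σ : ℂ) ^ 2)) * (y / (σ : ℂ) ^ 2)) y := by
    refine (((hid.fun_pow 2).div_const (2 * (σ : ℂ) ^ 2)).cexp).congr_deriv ?_
    field_simp
    push_cast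
    ring
  refine ((hp.const_mul ((-Complex.I) ^ m / (σ : ℂ) ^ m)).mul hq).congr_deriv ?_
  simp only [hermiteCoeff, Polynomial.hermite_succ, map_sub, map_mul, Polynomial.aeval_X, pow_succ]
  generalize Polynomial.aeval (Complex.I * ((y / σ : ℝ) : ℂ)) (Polynomial.hermite m) = p
  generalize Polynomial.aeval (Complex.I * ((y / σ : ℝ) : ℂ))
    (Polynomial.derivative (Polynomial.hermite m)) = q
  push_cast
  have hI : Complex.I ^ 2 = -1 := Complex.I_sq
  field_simp
  linear_combination ((y : ℂ) * p) * hI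

lemma gaussDeriv_zero_eq_exp {σ : ℝ} (hσ : 0 < σ) (z : ℝ) :
    gaussDeriv σ 0 z = ((1 / σ * (1 / √(2 * Real.pi)) : ℝ) : ℂ) *
      Complex.exp (-(z : ℂ) ^ 2 / (2 * (σ : ℂ) ^ 2)) := by
  have hσ' : (σ : ℂ) ≠ 0 := by exact_mod_cast hσ.ne'
  rw [gaussDeriv_zero hσ, kernel, ← mul_assoc, Complex.ofReal_mul, Complex.ofReal_exp]
  congr 2
  push_cast
  field_simp

/-- The Gaussian density times `x^k`, in terms of derivatives of the Gaussian density. -/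
lemma pow_mul_gaussDeriv_zero {σ : ℝ} (hσ : 0 < σ) (k : ℕ) (x y : ℝ) :
    (x : ℂ) ^ k * gaussDeriv σ 0 (y - x) = (σ : ℂ) ^ (2 * k) * ∑ m ∈ Finset.range (k + 1),
      (k.choose m : ℂ) * gaussDeriv σ (k - m) (y - x) * hermiteCoeff σ m y := by
  have hσ' : (σ : ℂ) ≠ 0 := by exact_mod_cast hσ.ne'
  set A : ℝ → ℂ := fun y => Complex.exp ((y : ℂ) ^ 2 / (2 * (σ : ℂ) ^ 2)) with hA
  set B : ℝ → ℂ := fun y => gaussDeriv σ 0 (y - x) with hB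
  have hAi : ∀ m, iteratedDeriv m A = fun y => hermiteCoeff σ m y * A y := fun m => by
    have := iteratedDeriv_eq_of_hasDerivAt_succ (g := fun m y => hermiteCoeff σ m y * A y)
      (fun j y => hasDerivAt_hermiteCoeff_mul_exp hσ j y) m
    rw [← this]
    congr 1
    ext y
    simp [hermiteCoeff]
  have hBi : ∀ m, iteratedDeriv m B = fun y => gaussDeriv σ m (y - x) :=
    iteratedDeriv_eq_of_hasDerivAt_succ (g := fun m y => gaussDeriv σ m (y - x))
      (fun j y => (hasDerivAt_gaussDeriv hσ j (y - x)).comp_sub_const y x)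
  have hAc : ContDiff ℝ k A := by
    have : ContDiff ℝ k fun y : ℝ => (y : ℂ) := Complex.ofRealCLM.contDiff
    fun_prop
  have hBc : ContDiff ℝ k B := by
    have : ContDiff ℝ k fun y : ℝ => (y : ℂ) := Complex.ofRealCLM.contDiff
    simp only [hB, gaussDeriv_zero_eq_exp hσ, Complex.ofReal_sub]
    fun_prop
  set c : ℂ := ((1 / σ * (1 / √(2 * Real.pi)) : ℝ) : ℂ) *
      Complex.exp (-(x : ℂ) ^ 2 / (2 * (σ : ℂ) ^ 2)) with hc
  -- The factor `A` cancels the y² in the Gaussian exponent, so each derivative in y multiplies by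
  -- x/σ².
  have hAB : (fun y => A y * B y) = fun y : ℝ => c * Complex.exp ((x / (σ : ℂ) ^ 2) * y) := by
    ext y
    simp only [hA, hB, hc, gaussDeriv_zero_eq_exp hσ]
    rw [mul_left_comm, ← Complex.exp_add, mul_assoc, ← Complex.exp_add]
    congr 2
    push_cast
    field_simp
    ring
  have hABi : iteratedDeriv k (fun y => A y * B y) y = (x / (σ : ℂ) ^ 2) ^ k * (A y * B y) := by
    have := iteratedDeriv_eq_of_hasDerivAt_succ
      (g := fun j y => (x / (σ : ℂ) ^ 2) ^ j * (A y * B y)) (fun j y => ?_) k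
    · simpa using congrFun this y
    · have hid : HasDerivAt (fun y : ℝ => (y : ℂ)) 1 y := Complex.ofRealCLM.hasDerivAt
      have e : ∀ y, A y * B y = c * Complex.exp ((x / (σ : ℂ) ^ 2) * y) := congrFun hAB
      simp only [e]
      refine (((hid.const_mul (x / (σ : ℂ) ^ 2)).cexp.const_mul c).const_mul _).congr_deriv ?_
      ring
  have hleib := iteratedDeriv_fun_mul (n := k) (x := y) hAc.contDiffAt hBc.contDiffAt
  rw [hABi] at hleib
  simp only [hAi, hBi] at hleib
  have hA0 : A y ≠ 0 := Complex.exp_ne_zero _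
  apply mul_left_cancel₀ hA0
  calc A y * ((x : ℂ) ^ k * gaussDeriv σ 0 (y - x))
      = (σ : ℂ) ^ (2 * k) * ((x / (σ : ℂ) ^ 2) ^ k * (A y * B y)) := by
        rw [div_pow, ← pow_mul]
        field_simp
        rfl
    _ = _ := by
        rw [hleib, mul_left_comm (A y), Finset.mul_sum _ _ (A y)]
        congr 1
        refine Finset.sum_congr rfl fun m _ => ?_
        ring

lemma momentEstimator_eq (σ : ℝ≥0) (k : ℕ) (a : ℝ) {n : ℕ} (s : Fin n → ℝ) (y : ℝ) :
    momentEstimator σ k a s y = ((σ : ℝ) : ℂ) ^ (2 * k) * (∑ m ∈ Finset.range (k + 1),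
      (k.choose m : ℂ) * (kdeDeriv (k - m) a s y : ℂ) * hermiteCoeff σ m y) /
        (kdeDeriv 0 a s y : ℂ) := by
  simp only [momentEstimator, hermiteCoeff, kdeDeriv_zero, mul_assoc]

lemma outputDensity_nonneg (Q : Measure ℝ) (σ : ℝ≥0) (y : ℝ) : 0 ≤ outputDensity Q σ y :=
  integral_nonneg fun _ => gaussianPDFReal_nonneg _ _ _

lemma condMoment_eq_div (Q : Measure ℝ) (σ : ℝ≥0) (k : ℕ) (y : ℝ) :
    condMoment Q σ k y =
      (∫ x, x ^ k * gaussianPDFReal 0 (σ ^ 2) (y - x) ∂Q) / outputDensity Q σ y := by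
  have hm : Measurable fun x => gaussianPDFReal 0 (σ ^ 2) (y - x) :=
    (measurable_gaussianPDFReal _ _).comp (measurable_const.sub measurable_id)
  rw [condMoment, condLaw, integral_withDensity_eq_integral_toReal_smul
    (hm.div_const _).ennreal_ofReal (ae_of_all _ fun _ => ENNReal.ofReal_lt_top), ← integral_div]
  refine integral_congr_ae (ae_of_all _ fun x => ?_)
  simp only [smul_eq_mul]
  rw [ENNReal.toReal_ofReal (div_nonneg (gaussianPDFReal_nonneg _ _ _)
    (outputDensity_nonneg _ _ _))]
  ring

/-- The conditional moment in terms of the derivatives of the density of `Y`. -/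
lemma condMoment_eq (Q : Measure ℝ) [IsProbabilityMeasure Q] {σ : ℝ≥0} (hσ : 0 < σ) (k : ℕ)
    (y : ℝ) : (condMoment Q σ k y : ℂ) = ((σ : ℝ) : ℂ) ^ (2 * k) *
      (∑ m ∈ Finset.range (k + 1), (k.choose m : ℂ) * smoothDeriv Q σ (k - m) y *
        hermiteCoeff σ m y) / smoothDeriv Q σ 0 y := by
  have hσ' : (0 : ℝ) < σ := NNReal.coe_pos.2 hσ
  rw [condMoment_eq_div, smoothDeriv_zero Q hσ, Complex.ofReal_div, ← integral_complex_ofReal]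
  congr 1
  have e : ∀ x : ℝ, ((x ^ k * gaussianPDFReal 0 (σ ^ 2) (y - x) : ℝ) : ℂ) =
      ((σ : ℝ) : ℂ) ^ (2 * k) * ∑ m ∈ Finset.range (k + 1),
        (k.choose m : ℂ) * gaussDeriv σ (k - m) (y - x) * hermiteCoeff σ m y := fun x => by
    rw [← pow_mul_gaussDeriv_zero hσ', gaussDeriv_zero hσ', one_div_mul_kernel]
    push_cast; rfl
  simp only [e]
  rw [integral_const_mul, integral_finsetSum]
  · simp only [integral_mul_const, integral_const_mul, smoothDeriv]
  · exact fun m _ => ((integrable_gaussDeriv_sub hσ' _ y Q).const_mul _).mul_const _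

/-! ### Deterministic bounds at a point -/

lemma exists_norm_hermiteCoeff_le {σ : ℝ} (hσ : 0 < σ) (k : ℕ) :
    ∃ B, 0 ≤ B ∧ ∀ m ≤ k, ∀ y, ‖hermiteCoeff σ m y‖ ≤ B * (1 + |y|) ^ k := by
  have key : ∀ m ≤ k, ∃ B, 0 ≤ B ∧ ∀ y, ‖hermiteCoeff σ m y‖ ≤ B * (1 + |y|) ^ k := by
    intro m hm
    refine ⟨‖(-Complex.I) ^ m / (σ : ℂ) ^ m‖ * ∑ i ∈ Finset.range (m + 1),
      ‖((Polynomial.hermite m).coeff i : ℂ)‖ * (1 / σ) ^ i, by positivity, fun y => ?_⟩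
    rw [hermiteCoeff, norm_mul, mul_assoc]
    gcongr
    rw [Polynomial.aeval_eq_sum_range, Polynomial.natDegree_hermite, Finset.sum_mul]
    refine (norm_sum_le _ _).trans (Finset.sum_le_sum fun i hi => ?_)
    rw [zsmul_eq_mul, norm_mul, norm_pow, norm_mul, Complex.norm_I, one_mul, Complex.norm_real,
      Real.norm_eq_abs, abs_div, abs_of_pos hσ, mul_assoc, div_eq_mul_one_div |y|, mul_pow,
      mul_comm (|y| ^ i)]
    gcongr
    have hi' : i ≤ k := by have := Finset.mem_range.1 hi; omega
    calc |y| ^ i ≤ (1 + |y|) ^ i := by gcongr; linarith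
      _ ≤ (1 + |y|) ^ k := pow_le_pow_right₀ (by linarith [abs_nonneg y]) hi'
  choose! B hB using key
  refine ⟨∑ m ∈ Finset.range (k + 1), B m, Finset.sum_nonneg fun m hm =>
    (hB m (by have := Finset.mem_range.1 hm; omega)).1, fun m hm y => ?_⟩
  refine ((hB m hm).2 y).trans ?_
  gcongr
  exact Finset.single_le_sum (f := B) (fun i hi =>
    (hB i (by have := Finset.mem_range.1 hi; omega)).1) (Finset.mem_range.2 (by omega))

/-- A sub-Gaussian lower bound on the density of `Y`. -/
lemma exists_le_outputDensity (Q : Measure ℝ) [IsProbabilityMeasure Q] {σ : ℝ≥0} (hσ : 0 < σ) :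
    ∃ c, 0 < c ∧ ∀ y, c * Real.exp (-y ^ 2 / (σ : ℝ) ^ 2) ≤ outputDensity Q σ y := by
  have hσ' : (0 : ℝ) < σ := NNReal.coe_pos.2 hσ
  have hle : ∀ x : ℝ, Real.exp (-x ^ 2 / (σ : ℝ) ^ 2) ≤ 1 := fun x =>
    Real.exp_le_one_iff.2 (div_nonpos_of_nonpos_of_nonneg (by nlinarith [sq_nonneg x])
      (by positivity))
  have hint : Integrable (fun x : ℝ => Real.exp (-x ^ 2 / (σ : ℝ) ^ 2)) Q :=
    (integrable_const (1 : ℝ)).mono' (by fun_prop) (ae_of_all _ fun x => by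
      rw [Real.norm_eq_abs, Real.abs_exp]; exact hle x)
  have hpos : 0 < ∫ x, Real.exp (-x ^ 2 / (σ : ℝ) ^ 2) ∂Q :=
    integral_exp_pos hint
  -- The witness comes from (y - x)² ≤ 2x² + 2y², which separates x from y in the exponent.
  refine ⟨(√(2 * Real.pi * (σ : ℝ) ^ 2))⁻¹ * ∫ x, Real.exp (-x ^ 2 / (σ : ℝ) ^ 2) ∂Q,
    by positivity, fun y => ?_⟩
  rw [outputDensity, mul_assoc, mul_comm (∫ x, _ ∂Q), ← integral_const_mul, ← integral_const_mul]
  have hpdf : Integrable (fun x => gaussianPDFReal 0 (σ ^ 2) (y - x)) Q := by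
    have := (integrable_gaussDeriv_sub hσ' 0 y Q).re
    simpa only [gaussDeriv_zero hσ', one_div_mul_kernel, RCLike.re_to_complex, Complex.ofReal_re]
      using this
  refine integral_mono ((hint.const_mul _).const_mul _) hpdf fun x => ?_
  simp only [gaussianPDFReal, NNReal.coe_pow, sub_zero]
  rw [← Real.exp_add]
  gcongr
  rw [← add_div, div_le_div_iff₀ (by positivity) (by positivity)]
  nlinarith [mul_nonneg (sq_nonneg (σ : ℝ)) (sq_nonneg (x + y))]

/-- The error of the estimator at a point, in terms of the errors of the estimators of the
derivatives of `f_Y`. -/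
lemma norm_momentEstimator_sub_le (Q : Measure ℝ) [IsProbabilityMeasure Q] {σ : ℝ≥0} (hσ : 0 < σ)
    (k : ℕ) (a : ℝ) {n : ℕ} (s : Fin n → ℝ) (y : ℝ) {ε c M B : ℝ} (hc : 0 < c)
    (hf : c ≤ outputDensity Q σ y) (hεc : ε ≤ c / 2)
    (hM : ∀ j ≤ k, ‖smoothDeriv Q σ j y‖ ≤ M) (hB : ∀ m ≤ k, ‖hermiteCoeff σ m y‖ ≤ B)
    (hε : ∀ j ≤ k, ‖(kdeDeriv j a s y : ℂ) - smoothDeriv Q σ j y‖ ≤ ε) :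
    ‖momentEstimator σ k a s y - (condMoment Q σ k y : ℂ)‖ ≤
      (σ : ℝ) ^ (2 * k) * (2 ^ k * B) * ε * (2 / c + 2 * M / c ^ 2) := by
  have hε0 : 0 ≤ ε := (norm_nonneg _).trans (hε 0 (Nat.zero_le k))
  have hB0 : 0 ≤ B := (norm_nonneg _).trans (hB 0 (Nat.zero_le k))
  have hM0 : 0 ≤ M := (norm_nonneg _).trans (hM 0 (Nat.zero_le k))
  have hsum : ∀ (d : ℕ → ℂ) (D : ℝ), (∀ j ≤ k, ‖d j‖ ≤ D) →
      ‖((σ : ℝ) : ℂ) ^ (2 * k) * ∑ m ∈ Finset.range (k + 1),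
        (k.choose m : ℂ) * d (k - m) * hermiteCoeff σ m y‖ ≤
      (σ : ℝ) ^ (2 * k) * (2 ^ k * B) * D := fun d D hd => by
    rw [norm_mul, norm_pow, Complex.norm_real, Real.norm_of_nonneg σ.coe_nonneg, mul_assoc]
    gcongr
    calc _ ≤ ∑ m ∈ Finset.range (k + 1), (k.choose m : ℝ) * D * B := by
          refine (norm_sum_le _ _).trans (Finset.sum_le_sum fun m hm => ?_)
          rw [norm_mul, norm_mul, Complex.norm_natCast]
          have hm' : m ≤ k := by have := Finset.mem_range.1 hm; omega
          have hD : 0 ≤ D := (norm_nonneg _).trans (hd 0 (Nat.zero_le k))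
          gcongr
          · exact hd _ (Nat.sub_le _ _)
          · exact hB m hm'
      _ = _ := by
          simp only [mul_assoc]
          rw [← Finset.sum_mul, ← Nat.cast_sum, Nat.sum_range_choose]
          push_cast; ring
  set Nh : ℂ := ((σ : ℝ) : ℂ) ^ (2 * k) * ∑ m ∈ Finset.range (k + 1),
    (k.choose m : ℂ) * (kdeDeriv (k - m) a s y : ℂ) * hermiteCoeff σ m y with hNh
  set N : ℂ := ((σ : ℝ) : ℂ) ^ (2 * k) * ∑ m ∈ Finset.range (k + 1),
    (k.choose m : ℂ) * smoothDeriv Q σ (k - m) y * hermiteCoeff σ m y with hN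
  have hNM : ‖N‖ ≤ (σ : ℝ) ^ (2 * k) * (2 ^ k * B) * M := hsum (fun j => smoothDeriv Q σ j y) M hM
  have hdiff : ‖Nh - N‖ ≤ (σ : ℝ) ^ (2 * k) * (2 ^ k * B) * ε := by
    have := hsum (fun j => (kdeDeriv j a s y : ℂ) - smoothDeriv Q σ j y) ε hε
    refine le_of_eq_of_le ?_ this
    rw [hNh, hN, ← mul_sub, ← Finset.sum_sub_distrib]
    congr 2
    refine Finset.sum_congr rfl fun m _ => ?_
    ring
  rw [momentEstimator_eq, condMoment_eq Q hσ, ← hNh, ← hN]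
  set f : ℂ := smoothDeriv Q σ 0 y with hfdef
  set fh : ℂ := (kdeDeriv 0 a s y : ℂ) with hfh
  have hff : c ≤ ‖f‖ := by
    rw [hfdef, smoothDeriv_zero Q hσ, Complex.norm_real]
    exact hf.trans (le_abs_self _)
  have hd0 : ‖fh - f‖ ≤ ε := hε 0 (Nat.zero_le k)
  have hfhc : c / 2 ≤ ‖fh‖ := by
    have := norm_sub_norm_le f fh
    rw [norm_sub_rev] at this
    linarith
  have hf0 : f ≠ 0 := norm_pos_iff.1 (by linarith)
  have hfh0 : fh ≠ 0 := norm_pos_iff.1 (by linarith)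
  -- Separates the numerator error, divided once by a density, from the denominator error, divided
  -- twice.
  have hid : Nh / fh - N / f = (Nh - N) / fh - N * (fh - f) / (f * fh) := by
    field_simp; ring
  rw [hid]
  set H := (σ : ℝ) ^ (2 * k) * (2 ^ k * B) with hH
  have hH0 : 0 ≤ H := by positivity
  clear_value Nh N f fh H
  calc _ ≤ ‖(Nh - N) / fh‖ + ‖N * (fh - f) / (f * fh)‖ := norm_sub_le _ _
    _ ≤ H * ε / (c / 2) + H * M * ε / (c * (c / 2)) := by
        rw [norm_div, norm_div, norm_mul, norm_mul]
        gcongr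
    _ = _ := by field_simp

/-! ### Asymptotics of the rates -/

open Filter in
lemma tendsto_natCast_rpow_neg {p : ℝ} (hp : 0 < p) :
    Tendsto (fun n : ℕ => (n : ℝ) ^ (-p)) atTop (nhds 0) :=
  (tendsto_rpow_neg_atTop hp).comp tendsto_natCast_atTop_atTop

lemma bandwidth_eq (u : ℝ) (n : ℕ) : bandwidth u n = (n : ℝ) ^ (-u) := by
  rw [bandwidth, Real.rpow_neg n.cast_nonneg, one_div]

open Filter in
lemma tendsto_halfWidth_mul_rpow (σ : ℝ≥0) (w : ℝ) {δ : ℝ} (hδ : 0 < δ) :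
    Tendsto (fun n : ℕ => halfWidth σ w n * (n : ℝ) ^ (-δ)) atTop (nhds 0) := by
  have h1 : Tendsto (fun x : ℝ => Real.log x / x ^ (2 * δ)) atTop (nhds 0) :=
    (isLittleO_log_rpow_atTop (by positivity : 0 < 2 * δ)).tendsto_div_nhds_zero
  have h2 := ((h1.comp tendsto_natCast_atTop_atTop).const_mul ((σ : ℝ) ^ 2 * w / 3)).sqrt
  rw [mul_zero, Real.sqrt_zero] at h2
  refine h2.congr fun n => ?_
  have e : (n : ℝ) ^ (-δ) = √(((n : ℝ) ^ (2 * δ))⁻¹) := by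
    rw [mul_comm, Real.rpow_mul n.cast_nonneg, Real.rpow_two, ← inv_pow,
      ← Real.rpow_neg n.cast_nonneg, Real.sqrt_sq (by positivity)]
  rw [e, halfWidth, ← Real.sqrt_mul' _ (by positivity)]
  congr 1
  simp only [Function.comp]
  ring

open Filter in
lemma tendsto_one_add_halfWidth_pow_mul_rpow (σ : ℝ≥0) {w : ℝ} (hw : 0 < w) (k : ℕ) :
    Tendsto (fun n : ℕ => (1 + halfWidth σ w n) ^ k * (n : ℝ) ^ (-(w / 3))) atTop (nhds 0) := by
  -- The exponent w/3 is shared among k + 1 factors: one for each factor 1 + t_n, and one spare so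
  -- that the limit is 0 even for k = 0.
  set δ : ℝ := w / 3 / (k + 1) with hδ
  have hδ0 : 0 < δ := by positivity
  have h1 := ((tendsto_natCast_rpow_neg hδ0).add (tendsto_halfWidth_mul_rpow σ w hδ0)).pow k
  have h2 := h1.mul (tendsto_natCast_rpow_neg hδ0)
  rw [mul_zero] at h2
  refine h2.congr fun n => ?_
  have e : (n : ℝ) ^ (-(w / 3)) = ((n : ℝ) ^ (-δ)) ^ (k + 1) := by
    rw [← Real.rpow_natCast, ← Real.rpow_mul n.cast_nonneg]
    congr 1
    rw [hδ]; push_cast; field_simp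
  rw [e, pow_succ, ← mul_assoc, ← mul_pow]
  ring

lemma rpow_neg_le_exp_of_abs_le_halfWidth {σ : ℝ≥0} (hσ : 0 < σ) {w : ℝ} (hw : 0 < w) {n : ℕ}
    (hn : 0 < n) {y : ℝ} (hy : |y| ≤ halfWidth σ w n) :
    (n : ℝ) ^ (-(w / 3)) ≤ Real.exp (-y ^ 2 / (σ : ℝ) ^ 2) := by
  have hσ' : (0 : ℝ) < σ := NNReal.coe_pos.2 hσ
  have hlog : 0 ≤ Real.log n := Real.log_natCast_nonneg n
  have h : y ^ 2 ≤ (σ : ℝ) ^ 2 * w * Real.log n / 3 := by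
    rw [← sq_abs, ← Real.sq_sqrt (by positivity : 0 ≤ (σ : ℝ) ^ 2 * w * Real.log n / 3)]
    exact pow_le_pow_left₀ (abs_nonneg y) hy 2
  rw [Real.rpow_def_of_pos (by exact_mod_cast hn), Real.exp_le_exp, le_div_iff₀ (by positivity)]
  linarith

open Filter in
lemma tendsto_sum_ofReal_div (M : ℕ → ℝ) (k : ℕ) {u : ℝ}
    (huk : u < 1 / (2 * (k : ℝ) + 4)) :
    Tendsto (fun n : ℕ => ∑ j ∈ Finset.range (k + 1), ENNReal.ofReal
      (4 * M j / (√n * bandwidth u n ^ (j + 1) * (n : ℝ) ^ (-u)))) atTop (nhds 0) := by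
  rw [← Finset.sum_const_zero (s := Finset.range (k + 1)) (M := ℝ≥0∞)]
  refine tendsto_finsetSum _ fun j hj => ?_
  have hj' : (j : ℝ) ≤ k := by exact_mod_cast Nat.lt_succ_iff.1 (Finset.mem_range.1 hj)
  rw [lt_div_iff₀ (by positivity)] at huk
  -- The j + 1 powers of the bandwidth and the tolerance n^(-u) together cost n^(u(j+2)); the worst
  -- case j = k is the condition on u.
  have hp : 0 < 1 / 2 - u * (j + 2) := by nlinarith
  have h := ENNReal.tendsto_ofReal ((tendsto_natCast_rpow_neg hp).const_mul (4 * M j))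
  rw [mul_zero, ENNReal.ofReal_zero] at h
  refine h.congr' ?_
  filter_upwards [eventually_gt_atTop 0] with n hn
  have hn' : (0 : ℝ) < n := by exact_mod_cast hn
  rw [bandwidth_eq, Real.sqrt_eq_rpow, ← Real.rpow_natCast, ← Real.rpow_mul hn'.le,
    ← Real.rpow_add hn', ← Real.rpow_add hn', div_eq_mul_inv (4 * M j), ← Real.rpow_neg hn'.le]
  congr 3
  push_cast
  ring

open Filter in
lemma eventually_bias_le (M : ℕ → ℝ) (k : ℕ) {u : ℝ} (hu : 0 < u) :
    ∀ᶠ n : ℕ in atTop, ∀ j ≤ k, bandwidth u n ^ 2 * M j ≤ (n : ℝ) ^ (-u) / 2 := by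
  have h : ∀ j, ∀ᶠ n : ℕ in atTop, bandwidth u n ^ 2 * M j ≤ (n : ℝ) ^ (-u) / 2 := fun j => by
    have h1 := (tendsto_natCast_rpow_neg hu).mul_const (M j)
    rw [zero_mul] at h1
    filter_upwards [h1.eventually_le_const (by norm_num : (0 : ℝ) < 1 / 2)] with n hn
    rw [bandwidth_eq, pow_two, mul_assoc, div_eq_mul_one_div]
    gcongr
  exact (Set.finite_Iic k).eventually_all.2 fun j _ => h j

open Filter in
lemma eventually_rate_lt (σ : ℝ≥0) {w : ℝ} (hw : 0 < w) (u : ℝ) (k : ℕ) {c M K : ℝ} (hc : 0 < c)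
    (hM : 0 ≤ M) (hK : 0 ≤ K) :
    ∀ᶠ n : ℕ in atTop, K * (1 + halfWidth σ w n) ^ k * (n : ℝ) ^ (-u) *
      (2 / (c * (n : ℝ) ^ (-(w / 3))) + 2 * M / (c * (n : ℝ) ^ (-(w / 3))) ^ 2) <
        1 / (n : ℝ) ^ (u - w) := by
  have h := (tendsto_one_add_halfWidth_pow_mul_rpow σ hw k).const_mul
    (K * (2 / c + 2 * M / c ^ 2))
  rw [mul_zero] at h
  filter_upwards [h.eventually_lt_const one_pos, eventually_gt_atTop 0] with n hlt hn
  have hn' : (0 : ℝ) < n := by exact_mod_cast hn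
  have hr1 : (n : ℝ) ^ (-(w / 3)) ≤ 1 :=
    Real.rpow_le_one_of_one_le_of_nonpos (by exact_mod_cast hn) (by linarith)
  have hr0 : 0 < (n : ℝ) ^ (-(w / 3)) := by positivity
  have hT : 0 ≤ halfWidth σ w n := Real.sqrt_nonneg _
  have e1 : 1 / (n : ℝ) ^ (u - w) = (n : ℝ) ^ (-(u - w)) := by
    rw [Real.rpow_neg hn'.le, one_div]
  -- Two of the three factors n^(-w/3) pay for the squared density in the denominator; the third
  -- beats `T` and the constants.
  have e2 : (n : ℝ) ^ (-u) = (n : ℝ) ^ (-(u - w)) * ((n : ℝ) ^ (-(w / 3))) ^ 3 := by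
    rw [← Real.rpow_natCast, ← Real.rpow_mul hn'.le, ← Real.rpow_add hn']
    congr 1; push_cast; ring
  have hg : 0 < (n : ℝ) ^ (-(u - w)) := by positivity
  rw [e1, e2]
  set r := (n : ℝ) ^ (-(w / 3))
  set g := (n : ℝ) ^ (-(u - w))
  set T := (1 + halfWidth σ w n) ^ k with hTdef
  have hT0 : 0 ≤ T := by positivity
  calc K * T * (g * r ^ 3) * (2 / (c * r) + 2 * M / (c * r) ^ 2)
      = g * (K * T * r) * (2 / c * r + 2 * M / c ^ 2) := by field_simp
    _ ≤ g * (K * T * r) * (2 / c * 1 + 2 * M / c ^ 2) := by gcongr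
    _ = g * (K * (2 / c + 2 * M / c ^ 2) * (T * r)) := by ring
    _ < g * 1 := by gcongr
    _ = g := mul_one g

open Filter in
lemma eventually_rpow_neg_le {u w c : ℝ} (hc : 0 < c) (hw : 0 < w) (hwu : w < u) :
    ∀ᶠ n : ℕ in atTop, (n : ℝ) ^ (-u) ≤ c * (n : ℝ) ^ (-(w / 3)) / 2 := by
  have hp : 0 < u - w / 3 := by linarith
  filter_upwards [(tendsto_natCast_rpow_neg hp).eventually_le_const (half_pos hc),
    eventually_gt_atTop 0] with n h hn
  have hn' : (0 : ℝ) < n := by exact_mod_cast hn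
  calc (n : ℝ) ^ (-u) = (n : ℝ) ^ (-(u - w / 3)) * (n : ℝ) ^ (-(w / 3)) := by
        rw [← Real.rpow_add hn']; congr 1; ring
    _ ≤ c / 2 * (n : ℝ) ^ (-(w / 3)) := by gcongr
    _ = _ := by ring

end GaussianEB

end

/-! ### Assembly -/

theorem mainTheorem11 (k : ℕ) (hk : 1 ≤ k) (σ : ℝ≥0) (hσ : 0 < σ) :
    ∃ C : ℝ, 0 < C ∧
      ∀ (u w : ℝ), 0 < u → u < 1 / (2 * (k : ℝ) + 4) → 0 < w → w < u →
      ∀ (Ω : Type*) [MeasurableSpace Ω] (P : Measure Ω) [IsProbabilityMeasure P]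
        (X N : Ω → ℝ) (Y : ℕ → Ω → ℝ),
        AEMeasurable X P → Integrable (fun ω => X ω ^ 2) P →
        HasLaw N (gaussianReal 0 (σ ^ 2)) P → IndepFun X N P →
        iIndepFun Y P → (∀ i, IdentDistrib (Y i) (fun ω => X ω + N ω) P P) →
        Filter.Tendsto
          (fun n : ℕ => P {ω | ENNReal.ofReal (C / (n : ℝ) ^ (u - w)) ≤
            GaussianEB.supError (P.map X) σ k (GaussianEB.bandwidth u n)
              (GaussianEB.halfWidth σ w n) (fun i : Fin n => Y i ω)})
          Filter.atTop (nhds 0) := by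
  -- Any positive constant would do, since the error is of smaller order than n^(-(u-w)).
  refine ⟨1, one_pos, fun u w hu huk hw hwu Ω _ P _ X N Y hX _ hN hXN hY hYd => ?_⟩
  have : IsProbabilityMeasure (P.map X) := Measure.isProbabilityMeasure_map hX
  have hσ' : (0 : ℝ) < σ := NNReal.coe_pos.2 hσ
  obtain ⟨c, hc, hdens⟩ := GaussianEB.exists_le_outputDensity (P.map X) hσ
  obtain ⟨B, hB0, hB⟩ := GaussianEB.exists_norm_hermiteCoeff_le hσ' k
  obtain ⟨M, hM0, hM⟩ : ∃ M, 0 ≤ M ∧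
      ∀ j ≤ k, ∀ y, ‖GaussianEB.smoothDeriv (P.map X) σ j y‖ ≤ M := by
    have hpos : ∀ j, 0 ≤ (2 * Real.pi)⁻¹ * ∫ t, GaussianEB.gaussWeight σ j t := fun j =>
      mul_nonneg (by positivity) (integral_nonneg fun t => GaussianEB.gaussWeight_nonneg _ _ _)
    refine ⟨∑ j ∈ Finset.range (k + 1), (2 * Real.pi)⁻¹ * ∫ t, GaussianEB.gaussWeight σ j t,
      Finset.sum_nonneg fun j _ => hpos j, fun j hj y => ?_⟩
    exact (GaussianEB.norm_smoothDeriv_le _ _ _ _).trans (Finset.single_le_sum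
      (f := fun j => (2 * Real.pi)⁻¹ * ∫ t, GaussianEB.gaussWeight σ j t) (fun j _ => hpos j)
      (Finset.mem_range.2 (by omega)))
  refine tendsto_of_tendsto_of_tendsto_of_le_of_le' tendsto_const_nhds
    (GaussianEB.tendsto_sum_ofReal_div (fun j => ∫ t, GaussianEB.gaussWeight 1 j t) k huk)
    (Filter.Eventually.of_forall fun n => zero_le) ?_
  filter_upwards [Filter.eventually_gt_atTop 0, GaussianEB.eventually_bias_le
      (fun j => ∫ t, GaussianEB.gaussWeight σ (j + 2) t) k hu,
    GaussianEB.eventually_rate_lt σ hw u k hc hM0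
      (by positivity : 0 ≤ (σ : ℝ) ^ (2 * k) * (2 ^ k * B)),
    GaussianEB.eventually_rpow_neg_le hc hw hwu] with n hn hbias hrate hsmall
  have hn' : (0 : ℝ) < n := by exact_mod_cast hn
  have ha : 0 < GaussianEB.bandwidth u n := by
    rw [GaussianEB.bandwidth_eq]; positivity
  refine (measure_mono fun ω hω => ?_).trans (GaussianEB.measure_exists_kdeDeriv_sub_gt_le hσ hX hN
    hXN hY hYd hn ha (by positivity : 0 < (n : ℝ) ^ (-u)) k hbias)
  by_contra hnot
  simp only [Set.mem_ofPred_eq, not_exists, not_and, not_lt] at hnot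
  -- If all derivative errors are at most n^(-u), the supremum is bounded by the left side of
  -- `hrate`; the strictness there excludes even equality with the threshold.
  refine absurd (hω.trans (iSup₂_le fun y hy => ENNReal.ofReal_le_ofReal ?_)) (not_le.2
    ((ENNReal.ofReal_lt_ofReal_iff (by positivity)).2 hrate))
  have hfy : c * (n : ℝ) ^ (-(w / 3)) ≤ GaussianEB.outputDensity (P.map X) σ y :=
    (mul_le_mul_of_nonneg_left (GaussianEB.rpow_neg_le_exp_of_abs_le_halfWidth hσ hw hn hy)
      hc.le).trans (hdens y)
  have hBy : ∀ m ≤ k, ‖GaussianEB.hermiteCoeff σ m y‖ ≤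
      B * (1 + GaussianEB.halfWidth σ w n) ^ k := fun m hm =>
    (hB m hm y).trans (by gcongr)
  refine (GaussianEB.norm_momentEstimator_sub_le (P.map X) hσ k _ _ y (by positivity) hfy hsmall
    (fun j hj => hM j hj y) hBy fun j hj => hnot j hj y).trans_eq ?_
  ring
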